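/- Let $G=(G_0,G_1,d,r,u,i,m)$ be an open localic groupoid (a groupoid internal to the category $\mathbf{Loc}$ of locales whose domain map $d$ is open). A (left) $G$-locale is a locale $X$ with an anchor map $p:X\to G_0$ and an associative, unital action $a:G_1\times_{G_0}X\to X$, where $G_1\times_{G_0}X$ is the pullback of $r$ and $p$, and $p\circ a=d\circ\pi_1$. A principal $G$-bundle over a locale $M$ is a $G$-locale $X$ with an open surjection $\pi:X\to M$ such that $\pi\circ a=\pi\circ\pi_2$ and the pairing map $\langle a,\pi_2\rangle:G_1\times_{G_0}X\to X\times_M X$ is an isomorphism. An equivariant map is a map of locales that commutes with the anchor maps and with the actions; an isomorphism of principal $G$-bundles over $M$ is an equivariant isomorphism of locales that commutes with the projections to $M$. **Lemma.** Let $X$ be a principal $G$-bundle over $M$ with projection $\pi$, and let $f:M'\to M$ be a map of locales. Then there is a principal $G$-bundle $\overline X$ over $M'$, with projection $\overline\pi:\overline X\to M'$, together with an equivariant map $\overline f:\overline X\to X$, such that the square $\pi\circ\overline f=f\circ\overline\pi$ commutes and is a pullback in $\mathbf{Loc}$ (so that $\overline X\cong X\times_M M'$). Moreover, for every principal $G$-bundle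 $X'$ over $M'$ with projection $\pi'$, and every equivariant map $f':X'\to X$ with $\pi\circ f'=f\circ\pi'$, there is a unique isomorphism $\varphi:X'\to\overline X$ of principal $G$-bundles over $M'$ with $\overline f\circ\varphi=f'$. -/

import Mathlib

open CategoryTheory CategoryTheory.Limits

universe u v

/-! ### Pullbacks of locales

Mathlib does not know that `Locale` has pullbacks.  We construct pushouts of frames. -/

namespace FrmPushout

section Construction

variable {A B C D : Type u} [Order.Frame A] [Order.Frame B] [Order.Frame C] [Order.Frame D]

/-- The lower sets of `B × C` that are closed under joins in each variable and do not distinguish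
`(b ⊓ φ a, c)` from `(b, c ⊓ ψ a)`. -/
structure IsBalanced (φ : FrameHom A B) (ψ : FrameHom A C) (U : LowerSet (B × C)) : Prop where
  sSup_left : ∀ (S : Set B) (c : C), (∀ b ∈ S, (b, c) ∈ U) → (sSup S, c) ∈ U
  sSup_right : ∀ (b : B) (S : Set C), (∀ c ∈ S, (b, c) ∈ U) → (b, sSup S) ∈ U
  balanced : ∀ (a : A) (b : B) (c : C), (b ⊓ φ a, c) ∈ U ↔ (b, c ⊓ ψ a) ∈ U

lemma mem_himp_iff {U V : LowerSet (B × C)} {x : B × C} :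
    x ∈ U ⇨ V ↔ ∀ y ≤ x, y ∈ U → y ∈ V := by
  rw [← LowerSet.Iic_le, le_himp_iff]
  constructor
  · intro h y hy hU
    exact h ⟨hy, hU⟩
  · rintro h y ⟨hy, hU⟩
    exact h y hy hU

/-- The underlying frame of the pushout `B ⊗_A C`, as a sublocale of the lower sets of `B × C`. -/
def tensor (φ : FrameHom A B) (ψ : FrameHom A C) : Sublocale (LowerSet (B × C)) where
  carrier := {U | IsBalanced φ ψ U}
  sInf_mem' 𝒮 h𝒮 := by
    refine ⟨fun S c h => ?_, fun b S h => ?_, fun a b c => ?_⟩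
    · simp only [LowerSet.mem_sInf_iff] at h ⊢
      exact fun U hU => (h𝒮 hU).sSup_left S c fun b hb => h b hb U hU
    · simp only [LowerSet.mem_sInf_iff] at h ⊢
      exact fun U hU => (h𝒮 hU).sSup_right b S fun c hc => h c hc U hU
    · simp only [LowerSet.mem_sInf_iff]
      exact forall₂_congr fun U hU => (h𝒮 hU).balanced a b c
  himp_mem' U V hV := by
    refine ⟨fun S c h => ?_, fun b S h => ?_, fun a b c => ?_⟩
    · rw [mem_himp_iff]
      rintro ⟨b', c'⟩ ⟨hb, hc⟩ hU
      have hb' : b' = sSup ((fun b => b' ⊓ b) '' S) := by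
        rw [sSup_image, ← inf_sSup_eq]
        exact (inf_eq_left.2 hb).symm
      rw [hb']
      refine hV.sSup_left _ _ ?_
      rintro _ ⟨b, hb, rfl⟩
      exact mem_himp_iff.1 (h b hb) _ ⟨inf_le_right, hc⟩ (U.lower (a := (b', c')) ⟨inf_le_left, le_rfl⟩ hU)
    · rw [mem_himp_iff]
      rintro ⟨b', c'⟩ ⟨hb, hc⟩ hU
      have hc' : c' = sSup ((fun c => c' ⊓ c) '' S) := by
        rw [sSup_image, ← inf_sSup_eq]
        exact (inf_eq_left.2 hc).symm
      rw [hc']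
      refine hV.sSup_right _ _ ?_
      rintro _ ⟨c, hc, rfl⟩
      exact mem_himp_iff.1 (h c hc) _ ⟨hb, inf_le_right⟩ (U.lower (a := (b', c')) ⟨le_rfl, inf_le_left⟩ hU)
    · simp only [mem_himp_iff]
      constructor
      · rintro h ⟨b', c'⟩ ⟨hb, hc⟩ hU
        have hc' : c' ⊓ ψ a = c' := inf_eq_left.2 (hc.trans inf_le_right)
        rw [← hc', ← hV.balanced]
        exact h _ ⟨inf_le_inf_right _ hb, hc.trans inf_le_left⟩
          (U.lower (a := (b', c')) ⟨inf_le_left, le_rfl⟩ hU)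
      · rintro h ⟨b', c'⟩ ⟨hb, hc⟩ hU
        have hb' : b' ⊓ φ a = b' := inf_eq_left.2 (hb.trans inf_le_right)
        rw [← hb', hV.balanced]
        exact h _ ⟨hb.trans inf_le_left, inf_le_inf_right _ hc⟩
          (U.lower (a := (b', c')) ⟨le_rfl, inf_le_left⟩ hU)

variable (φ : FrameHom A B) (ψ : FrameHom A C)

lemma restrict_le_iff {U : LowerSet (B × C)} {V : tensor φ ψ} :
    (tensor φ ψ).restrict U ≤ V ↔ U ≤ V.1 :=
  (tensor φ ψ).giRestrict.gc U V

/-- The element `b ⊗ c` of the pushout. -/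
def tmul (b : B) (c : C) : tensor φ ψ := (tensor φ ψ).restrict (LowerSet.Iic (b, c))

variable {φ ψ}

lemma tmul_le_iff {b : B} {c : C} {V : tensor φ ψ} : tmul φ ψ b c ≤ V ↔ (b, c) ∈ V.1 := by
  rw [tmul, restrict_le_iff, LowerSet.Iic_le]

lemma isBalanced (V : tensor φ ψ) : IsBalanced φ ψ V.1 := V.2

lemma tmul_inf (b b' : B) (c c' : C) :
    tmul φ ψ (b ⊓ b') (c ⊓ c') = tmul φ ψ b c ⊓ tmul φ ψ b' c' := by
  rw [tmul, tmul, tmul, ← map_inf]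
  refine congrArg _ (LowerSet.ext (Set.ext fun x => ?_))
  simp only [LowerSet.coe_Iic, LowerSet.coe_inf, Set.mem_inter_iff, Set.mem_Iic, Prod.le_def,
    le_inf_iff]
  tauto

lemma tmul_top : tmul φ ψ ⊤ ⊤ = ⊤ := by
  rw [tmul, ← map_top (tensor φ ψ).restrict]
  congr 1
  ext x
  simp [Prod.le_def]

lemma sSup_tmul (S : Set B) (c : C) :
    tmul φ ψ (sSup S) c = sSup ((fun b => tmul φ ψ b c) '' S) := by
  refine eq_of_forall_ge_iff fun V => ?_
  rw [tmul_le_iff, sSup_le_iff, Set.forall_mem_image]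
  simp only [tmul_le_iff]
  exact ⟨fun h b hb => V.1.lower (a := (sSup S, c)) ⟨le_sSup hb, le_rfl⟩ h, (isBalanced V).sSup_left S c⟩

lemma tmul_sSup (b : B) (S : Set C) :
    tmul φ ψ b (sSup S) = sSup ((fun c => tmul φ ψ b c) '' S) := by
  refine eq_of_forall_ge_iff fun V => ?_
  rw [tmul_le_iff, sSup_le_iff, Set.forall_mem_image]
  simp only [tmul_le_iff]
  exact ⟨fun h c hc => V.1.lower (a := (b, sSup S)) ⟨le_rfl, le_sSup hc⟩ h, (isBalanced V).sSup_right b S⟩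

lemma eq_sSup_tmul (V : tensor φ ψ) :
    V = sSup ((fun x : B × C => tmul φ ψ x.1 x.2) '' (V.1 : Set (B × C))) := by
  refine eq_of_forall_ge_iff fun W => ?_
  rw [sSup_le_iff, Set.forall_mem_image]
  simp only [tmul_le_iff]
  exact ⟨fun h x hx => h hx, fun h x hx => h hx⟩

variable (φ ψ)

/-- The left coprojection `b ↦ b ⊗ ⊤`. -/
def inl : FrameHom B (tensor φ ψ) where
  toFun b := tmul φ ψ b ⊤
  map_inf' b b' := by rw [← tmul_inf, inf_top_eq]
  map_top' := tmul_top
  map_sSup' S := sSup_tmul S ⊤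

/-- The right coprojection `c ↦ ⊤ ⊗ c`. -/
def inr : FrameHom C (tensor φ ψ) where
  toFun c := tmul φ ψ ⊤ c
  map_inf' c c' := by rw [← tmul_inf, inf_top_eq]
  map_top' := tmul_top
  map_sSup' S := tmul_sSup ⊤ S

lemma condition (a : A) : inl φ ψ (φ a) = inr φ ψ (ψ a) := by
  refine eq_of_forall_ge_iff fun V => ?_
  change tmul φ ψ (φ a) ⊤ ≤ V ↔ tmul φ ψ ⊤ (ψ a) ≤ V
  rw [tmul_le_iff, tmul_le_iff]
  simpa using (isBalanced V).balanced a ⊤ ⊤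

lemma inl_inf_inr (b : B) (c : C) : inl φ ψ b ⊓ inr φ ψ c = tmul φ ψ b c := by
  change tmul φ ψ b ⊤ ⊓ tmul φ ψ ⊤ c = _
  rw [← tmul_inf, inf_top_eq, top_inf_eq]

variable {φ ψ}

/-- The lower set of all `(b, c)` with `f b ⊓ g c ≤ d`. -/
def below (f : FrameHom B D) (g : FrameHom C D) (h : ∀ a, f (φ a) = g (ψ a)) (d : D) :
    tensor φ ψ :=
  ⟨⟨{x | f x.1 ⊓ g x.2 ≤ d}, fun x y hyx hx =>
      (inf_le_inf (OrderHomClass.mono f hyx.1) (OrderHomClass.mono g hyx.2)).trans hx⟩, by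
    refine ⟨fun S c hS => ?_, fun b S hS => ?_, fun a b c => ?_⟩
    · change f (sSup S) ⊓ g c ≤ d
      rw [map_sSup, sSup_inf_eq, iSup₂_le_iff]
      rintro _ ⟨b, hb, rfl⟩
      exact hS b hb
    · change f b ⊓ g (sSup S) ≤ d
      rw [map_sSup, inf_sSup_eq, iSup₂_le_iff]
      rintro _ ⟨c, hc, rfl⟩
      exact hS c hc
    · change f (b ⊓ φ a) ⊓ g c ≤ d ↔ f b ⊓ g (c ⊓ ψ a) ≤ d
      rw [map_inf, map_inf, h, inf_assoc, inf_comm (g c)]⟩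

/-- The value of the induced map out of the pushout. -/
def descFun (f : FrameHom B D) (g : FrameHom C D) (V : tensor φ ψ) : D :=
  ⨆ x : B × C, ⨆ _ : x ∈ V.1, f x.1 ⊓ g x.2

lemma descFun_gc (f : FrameHom B D) (g : FrameHom C D) (h : ∀ a, f (φ a) = g (ψ a)) :
    GaloisConnection (descFun (φ := φ) (ψ := ψ) f g) (below f g h) := fun V d => by
  rw [descFun, iSup₂_le_iff]
  exact ⟨fun H x hx => H x hx, fun H x hx => H hx⟩

lemma descFun_tmul (f : FrameHom B D) (g : FrameHom C D) (h : ∀ a, f (φ a) = g (ψ a))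
    (b : B) (c : C) : descFun f g (tmul φ ψ b c) = f b ⊓ g c := by
  refine eq_of_forall_ge_iff fun d => ?_
  rw [descFun_gc f g h, tmul_le_iff]
  rfl

/-- The map out of the pushout induced by a commutative square. -/
def desc (f : FrameHom B D) (g : FrameHom C D) (h : ∀ a, f (φ a) = g (ψ a)) :
    FrameHom (tensor φ ψ) D where
  toFun := descFun f g
  map_inf' V W := by
    refine le_antisymm ?_ ?_
    · exact (descFun_gc f g h).monotone_l.map_inf_le V W
    · simp only [descFun, iSup_inf_eq, inf_iSup_eq, iSup_le_iff]
      intro x hx y hy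
      refine le_trans ?_ (le_iSup₂ (x ⊓ y) ⟨V.1.lower inf_le_right ?_, W.1.lower inf_le_left ?_⟩)
      all_goals first
        | assumption
        | simp only [Prod.fst_inf, Prod.snd_inf, map_inf]
          exact le_of_eq (by ac_rfl)
  map_top' := by
    rw [← tmul_top, descFun_tmul f g h, map_top, map_top, inf_top_eq]
  map_sSup' S := by
    rw [(descFun_gc f g h).l_sSup, sSup_image]

lemma desc_inl (f : FrameHom B D) (g : FrameHom C D) (h : ∀ a, f (φ a) = g (ψ a)) (b : B) :
    desc f g h (inl φ ψ b) = f b :=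
  (descFun_tmul f g h b ⊤).trans (by rw [map_top, inf_top_eq])

lemma desc_inr (f : FrameHom B D) (g : FrameHom C D) (h : ∀ a, f (φ a) = g (ψ a)) (c : C) :
    desc f g h (inr φ ψ c) = g c :=
  (descFun_tmul f g h ⊤ c).trans (by rw [map_top, top_inf_eq])

lemma hom_ext {k l : FrameHom (tensor φ ψ) D} (h₁ : ∀ b, k (inl φ ψ b) = l (inl φ ψ b))
    (h₂ : ∀ c, k (inr φ ψ c) = l (inr φ ψ c)) (V : tensor φ ψ) : k V = l V := by
  rw [eq_sSup_tmul V, map_sSup, map_sSup, Set.image_image, Set.image_image]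
  congr 1
  refine Set.image_congr fun x _ => ?_
  rw [← inl_inf_inr, map_inf, map_inf, h₁, h₂]

end Construction

end FrmPushout

instance Frm.hasPushouts : HasPushouts Frm.{u} := by
  have key : ∀ {A B C : Frm.{u}} (φ : A ⟶ B) (ψ : A ⟶ C), HasColimit (span φ ψ) := by
    intro A B C φ ψ
    have hs (s : PushoutCocone φ ψ) (a : A) :
        s.inl.hom (φ.hom a) = s.inr.hom (ψ.hom a) :=
      congrArg (fun k => k.hom a) s.condition
    refine HasColimit.mk ⟨PushoutCocone.mk
      (Frm.ofHom (FrmPushout.inl φ.hom ψ.hom)) (Frm.ofHom (FrmPushout.inr φ.hom ψ.hom))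
      (Frm.ext fun a => FrmPushout.condition φ.hom ψ.hom a), ?_⟩
    refine PushoutCocone.IsColimit.mk _
      (fun s => Frm.ofHom (FrmPushout.desc s.inl.hom s.inr.hom (hs s)))
      (fun s => Frm.ext fun b => FrmPushout.desc_inl _ _ (hs s) b)
      (fun s => Frm.ext fun c => FrmPushout.desc_inr _ _ (hs s) c)
      (fun s k h₁ h₂ => Frm.ext fun V => ?_)
    refine FrmPushout.hom_ext (k := k.hom) (fun b => ?_) (fun c => ?_) V
    · exact (congrArg (fun k => k.hom b) h₁).trans (FrmPushout.desc_inl _ _ (hs s) b).symm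
    · exact (congrArg (fun k => k.hom c) h₂).trans (FrmPushout.desc_inr _ _ (hs s) c).symm
  exact @hasPushouts_of_hasColimit_span _ _ (fun {_ _ _ φ ψ} => key φ ψ)

instance Locale.hasPullbacks : HasPullbacks Locale.{u} :=
  inferInstanceAs (HasPullbacks Frm.{u}ᵒᵖ)

/-! ### Open maps and surjections of locales -/

namespace Locale

/-- The inverse image homomorphism `f^*` of a map of locales `f`. -/
def invImage {L M : Locale.{u}} (f : L ⟶ M) : FrameHom M L :=
  Frm.Hom.hom (Quiver.Hom.unop f)

/-- A map of locales `f` is open if `f^*` has a left adjoint `f_!` that satisfies the Frobenius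
condition. -/
def IsOpenMap {L M : Locale.{u}} (f : L ⟶ M) : Prop :=
  ∃ directImage : L → M, GaloisConnection directImage (invImage f) ∧
    ∀ (a : L) (b : M), directImage (a ⊓ invImage f b) = directImage a ⊓ b

/-- A map of locales is surjective if its inverse image homomorphism is injective. -/
def IsSurjective {L M : Locale.{u}} (f : L ⟶ M) : Prop :=
  Function.Injective (invImage f)

end Locale

/-! ### Internal groupoids -/

/-- A groupoid internal to a category with pullbacks.  The pair `(g, h)` of arrows is composable
if `r g = d h`, and then `g h = m (g, h)` has `d (g h) = d g` and `r (g h) = r h`. -/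
structure InternalGroupoid (𝒞 : Type v) [Category.{u} 𝒞] [HasPullbacks 𝒞] where
  /-- The object of objects. -/
  G₀ : 𝒞
  /-- The object of arrows. -/
  G₁ : 𝒞
  /-- The domain map. -/
  d : G₁ ⟶ G₀
  /-- The range map. -/
  r : G₁ ⟶ G₀
  /-- The unit map. -/
  u : G₀ ⟶ G₁
  /-- The inversion map. -/
  i : G₁ ⟶ G₁
  /-- The multiplication map. -/
  m : pullback r d ⟶ G₁
  u_d : u ≫ d = 𝟙 G₀
  u_r : u ≫ r = 𝟙 G₀
  m_d : m ≫ d = pullback.fst r d ≫ d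
  m_r : m ≫ r = pullback.snd r d ≫ r
  /-- `u (d g) g = g` -/
  unit_mul : pullback.lift (d ≫ u) (𝟙 G₁) (by simp [u_r]) ≫ m = 𝟙 G₁
  /-- `g u (r g) = g` -/
  mul_unit : pullback.lift (𝟙 G₁) (r ≫ u) (by simp [u_d]) ≫ m = 𝟙 G₁
  /-- `(g h) k = g (h k)`, on triples `(g, (h, k))` -/
  assoc :
    pullback.lift
        (pullback.lift (pullback.fst r (pullback.fst r d ≫ d))
          (pullback.snd r (pullback.fst r d ≫ d) ≫ pullback.fst r d)
          (by simp [pullback.condition]) ≫ m)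
        (pullback.snd r (pullback.fst r d ≫ d) ≫ pullback.snd r d)
        (by rw [Category.assoc, m_r, pullback.lift_snd_assoc, Category.assoc, Category.assoc,
          pullback.condition]) ≫ m =
      pullback.lift (pullback.fst r (pullback.fst r d ≫ d))
        (pullback.snd r (pullback.fst r d ≫ d) ≫ m)
        (by simp [m_d, pullback.condition]) ≫ m
  i_d : i ≫ d = r
  i_r : i ≫ r = d
  /-- `g g⁻¹ = u (d g)` -/
  mul_inv : pullback.lift (𝟙 G₁) i (by simp [i_d]) ≫ m = d ≫ u
  /-- `g⁻¹ g = u (r g)` -/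
  inv_mul : pullback.lift i (𝟙 G₁) (by simp [i_r]) ≫ m = r ≫ u

/-- A localic groupoid is a groupoid internal to locales. -/
abbrev LocalicGroupoid := InternalGroupoid Locale.{u}

namespace LocalicGroupoid

/-- A localic groupoid is open if its domain map is open. -/
def IsOpen (G : LocalicGroupoid.{u}) : Prop := Locale.IsOpenMap G.d

end LocalicGroupoid

/-! ### Actions and bundles -/

/-- A left `G`-locale: `g x` is defined if `r g = p x`, and then `p (g x) = d g`. -/
structure GLocale (G : LocalicGroupoid.{u}) where
  /-- The underlying locale. -/
  X : Locale.{u}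
  /-- The anchor map. -/
  p : X ⟶ G.G₀
  /-- The action, on the pullback `G₁ ×_{G₀} X`. -/
  act : pullback G.r p ⟶ X
  act_p : act ≫ p = pullback.fst G.r p ≫ G.d
  /-- `(g h) x = g (h x)`, on triples `(g, (h, x))` -/
  assoc :
    pullback.lift
        (pullback.lift (pullback.fst G.r (pullback.fst G.r p ≫ G.d))
          (pullback.snd G.r (pullback.fst G.r p ≫ G.d) ≫ pullback.fst G.r p)
          (by simp [pullback.condition]) ≫ G.m)
        (pullback.snd G.r (pullback.fst G.r p ≫ G.d) ≫ pullback.snd G.r p)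
        (by rw [Category.assoc, G.m_r, pullback.lift_snd_assoc, Category.assoc, Category.assoc,
          pullback.condition]) ≫ act =
      pullback.lift (pullback.fst G.r (pullback.fst G.r p ≫ G.d))
        (pullback.snd G.r (pullback.fst G.r p ≫ G.d) ≫ act)
        (by simp [act_p, pullback.condition]) ≫ act
  /-- `u (p x) x = x` -/
  unit_act : pullback.lift (p ≫ G.u) (𝟙 X) (by simp [G.u_r]) ≫ act = 𝟙 X

namespace GLocale

variable {G : LocalicGroupoid.{u}}

/-- A map `f : X ⟶ Y` of `G`-locales is equivariant if it is a map over `G₀` and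
`f (g x) = g (f x)`. -/
structure IsEquivariant (X Y : GLocale G) (f : X.X ⟶ Y.X) : Prop where
  comp_p : f ≫ Y.p = X.p
  act_comp :
    X.act ≫ f =
      pullback.lift (pullback.fst G.r X.p) (pullback.snd G.r X.p ≫ f)
        (by simp [comp_p, pullback.condition]) ≫ Y.act

end GLocale

/-- A `G`-bundle over `M`: a `G`-locale with an invariant map to `M`. -/
structure GBundle (G : LocalicGroupoid.{u}) (M : Locale.{u}) extends GLocale G where
  /-- The projection to the base. -/
  π : X ⟶ M
  act_π : act ≫ π = pullback.snd G.r p ≫ π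

namespace GBundle

variable {G : LocalicGroupoid.{u}} {M : Locale.{u}}

/-- The pairing map `(g, x) ↦ (g x, x)` from `G₁ ×_{G₀} X` to `X ×_M X`. -/
noncomputable def pairing (X : GBundle G M) : pullback G.r X.p ⟶ pullback X.π X.π :=
  pullback.lift X.act (pullback.snd G.r X.p) X.act_π

/-- A `G`-bundle is principal if its pairing map is an isomorphism and its projection is an open
surjection. -/
structure IsPrincipal (X : GBundle G M) : Prop where
  isIso_pairing : IsIso X.pairing
  isOpenMap_π : Locale.IsOpenMap X.π
  isSurjective_π : Locale.IsSurjective X.π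

/-- An isomorphism of locales `φ : X ≅ Y` is an isomorphism of `G`-bundles over `M` if it is
equivariant and commutes with the projections to `M`. -/
structure IsBundleIso (X Y : GBundle G M) (φ : X.X ≅ Y.X) : Prop where
  equivariant : X.toGLocale.IsEquivariant Y.toGLocale φ.hom
  comp_π : φ.hom ≫ Y.π = X.π

end GBundle

/-! The bundle is the pullback `X ×_M M'` with action `g (x, m') = (g x, m')`, which lies over `M`
because `π` is invariant. Principality says that the action and the second projection exhibit `G₁
×_{G₀} X` as the kernel pair of an open surjection. The kernel pair condition passes to the base
change by pasting pullbacks, and open surjections are stable under pullback.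

A competing `X'` maps uniquely into the pullback, and this map `φ` is equivariant since both its
components respect the actions. It remains to see that an equivariant map `φ : X ⟶ Y` of principal
bundles over one base is invertible. The map `(g, x) ↦ g (φ x)` is a pullback of `π` along the
projection of `Y`, hence an open surjection, and the pullback of `φ` along it is an identity.
Isomorphisms descend along open surjections.

Both stability and descent rest on the Beck–Chevalley identity `k fst^* = g^* l` for the left
adjoints `l ⊣ e^*` and `k ⊣ snd^*` in a pullback square with `e` open. It is computed in the tensor
product of frames. -/

namespace FrmPushout

/-! ### Beck–Chevalley in the tensor product of frames -/

variable {A B C : Type u} [Order.Frame A] [Order.Frame B] [Order.Frame C]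
  {φ : FrameHom A B} {ψ : FrameHom A C} {l : B → A}

lemma tmul_inf_map (a : A) (b : B) (c : C) :
    tmul φ ψ (b ⊓ φ a) c = tmul φ ψ b (c ⊓ ψ a) := by
  refine eq_of_forall_ge_iff fun V => ?_
  rw [tmul_le_iff, tmul_le_iff]
  exact (isBalanced V).balanced a b c

/-- Membership in `⊤ ⊗ c₀` when `φ` has a left adjoint satisfying the Frobenius condition. -/
lemma mem_inr_iff (gc : GaloisConnection l φ) (frob : ∀ b a, l (b ⊓ φ a) = l b ⊓ a)
    {b : B} {c c₀ : C} : (b, c) ∈ (inr φ ψ c₀).1 ↔ ψ (l b) ⊓ c ≤ c₀ := by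
  rw [← tmul_le_iff]
  constructor
  · intro h
    -- The right-hand condition cuts out an element of the tensor product containing `(⊤, c₀)`, so
    -- it lies above `⊤ ⊗ c₀`; Frobenius is what makes it balanced.
    have hR : IsBalanced φ ψ ⟨{x | ψ (l x.1) ⊓ x.2 ≤ c₀}, fun x y hyx hx =>
        (inf_le_inf (OrderHomClass.mono ψ (gc.monotone_l hyx.1)) hyx.2).trans hx⟩ := by
      refine ⟨fun S c hS => ?_, fun b S hS => ?_, fun a b c => ?_⟩
      · change ψ (l (sSup S)) ⊓ c ≤ c₀
        rw [gc.l_sSup, ← sSup_image, map_sSup, sSup_inf_eq, iSup₂_le_iff]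
        rintro _ ⟨_, ⟨b, hb, rfl⟩, rfl⟩
        exact hS b hb
      · change ψ (l b) ⊓ sSup S ≤ c₀
        rw [inf_sSup_eq, iSup₂_le_iff]
        exact hS
      · change ψ (l (b ⊓ φ a)) ⊓ c ≤ c₀ ↔ ψ (l b) ⊓ (c ⊓ ψ a) ≤ c₀
        rw [frob, map_inf, inf_assoc, inf_comm c]
    have hle : inr φ ψ c₀ ≤ (⟨_, hR⟩ : tensor φ ψ) :=
      tmul_le_iff.2 (show ψ (l ⊤) ⊓ c₀ ≤ c₀ from inf_le_right)
    exact tmul_le_iff.1 (h.trans hle)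
  · intro h
    -- Since `b = b ⊓ φ (l b)`, the factor `φ (l b)` can cross the tensor sign: `b ⊗ c = b ⊗ (ψ (l
    -- b) ⊓ c) ≤ ⊤ ⊗ c₀`.
    rw [← inf_eq_left.2 (gc.le_u_l b), tmul_inf_map, inf_comm c, tmul_le_iff]
    exact (inr φ ψ c₀).1.lower (a := (⊤, c₀)) ⟨le_top, h⟩ (tmul_le_iff.1 le_rfl)

/-- The left adjoint of the right coprojection induced by a map `l : B → A`. -/
def directImage (φ : FrameHom A B) (ψ : FrameHom A C) (l : B → A) (V : tensor φ ψ) : C :=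
  ⨆ x : B × C, ⨆ _ : x ∈ V.1, ψ (l x.1) ⊓ x.2

lemma directImage_gc (gc : GaloisConnection l φ) (frob : ∀ b a, l (b ⊓ φ a) = l b ⊓ a) :
    GaloisConnection (directImage φ ψ l) (inr φ ψ) := fun V c => by
  rw [directImage, iSup₂_le_iff]
  exact ⟨fun H x hx => (mem_inr_iff gc frob).2 (H x hx),
    fun H x hx => (mem_inr_iff gc frob).1 (H hx)⟩

lemma directImage_inf_inr (gc : GaloisConnection l φ) (frob : ∀ b a, l (b ⊓ φ a) = l b ⊓ a)
    (V : tensor φ ψ) (c : C) :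
    directImage φ ψ l (V ⊓ inr φ ψ c) = directImage φ ψ l V ⊓ c := by
  have hgc := directImage_gc (ψ := ψ) gc frob
  refine le_antisymm (le_inf (hgc.monotone_l inf_le_left)
    (hgc.l_le inf_le_right)) ?_
  rw [directImage, iSup₂_inf_eq, iSup₂_le_iff]
  intro x hx
  rw [inf_assoc]
  -- Shrinking the second coordinate to `x.2 ⊓ c` keeps the pair in `V` and puts it in `⊤ ⊗ c` as
  -- well.
  refine le_iSup₂_of_le (x.1, x.2 ⊓ c) ⟨V.1.lower (a := x) ⟨le_rfl, inf_le_left⟩ hx, ?_⟩ le_rfl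
  exact (mem_inr_iff gc frob).2 (inf_le_right.trans inf_le_right)

lemma directImage_inl (gc : GaloisConnection l φ) (frob : ∀ b a, l (b ⊓ φ a) = l b ⊓ a)
    (b : B) : directImage φ ψ l (inl φ ψ b) = ψ (l b) := by
  refine eq_of_forall_ge_iff fun c => ?_
  rw [directImage_gc gc frob]
  change tmul φ ψ b ⊤ ≤ _ ↔ _
  rw [tmul_le_iff, mem_inr_iff gc frob, inf_top_eq]

end FrmPushout

/-! ### Stability and descent along open surjections -/

namespace Locale

lemma invImage_comp {K L M : Locale.{u}} (f : K ⟶ L) (g : L ⟶ M) (x : M) :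
    invImage (f ≫ g) x = invImage f (invImage g x) := rfl

/-- The fibre product of locales given by the tensor product of frames. -/
lemma isPullback_tensor {E L B : Locale.{u}} (e : E ⟶ B) (g : L ⟶ B) :
    IsPullback
      (Quiver.Hom.op (Frm.ofHom (FrmPushout.inl (invImage e) (invImage g))) :
        (Opposite.op (Frm.of (FrmPushout.tensor (invImage e) (invImage g))) : Locale.{u}) ⟶ E)
      (Quiver.Hom.op (Frm.ofHom (FrmPushout.inr (invImage e) (invImage g)))) e g := by
  have h : IsPushout e.unop g.unop
      (Frm.ofHom (FrmPushout.inl (invImage e) (invImage g)))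
      (Frm.ofHom (FrmPushout.inr (invImage e) (invImage g))) := by
    have hs (s : PushoutCocone e.unop g.unop) (a : B) :
        s.inl.hom (invImage e a) = s.inr.hom (invImage g a) :=
      congrArg (fun k => k.hom a) s.condition
    refine ⟨⟨Frm.ext fun a => FrmPushout.condition (invImage e) (invImage g) a⟩,
      ⟨PushoutCocone.IsColimit.mk _
        (fun s => Frm.ofHom (FrmPushout.desc s.inl.hom s.inr.hom (hs s)))
        (fun s => Frm.ext fun b => FrmPushout.desc_inl _ _ (hs s) b)
        (fun s => Frm.ext fun c => FrmPushout.desc_inr _ _ (hs s) c)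
        (fun s k h₁ h₂ => Frm.ext fun V => ?_)⟩⟩
    refine FrmPushout.hom_ext (k := k.hom) (fun b => ?_) (fun c => ?_) V
    · exact (congrArg (fun k => k.hom b) h₁).trans (FrmPushout.desc_inl _ _ (hs s) b).symm
    · exact (congrArg (fun k => k.hom c) h₂).trans (FrmPushout.desc_inr _ _ (hs s) c).symm
  exact h.op.flip

variable {P E L B : Locale.{u}} {fst : P ⟶ E} {snd : P ⟶ L} {e : E ⟶ B} {g : L ⟶ B}

lemma invImage_hom_inv {L M : Locale.{u}} (θ : L ≅ M) (x : L) :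
    invImage θ.hom (invImage θ.inv x) = x := by
  rw [← invImage_comp, θ.hom_inv_id]
  rfl

lemma invImage_inv_hom {L M : Locale.{u}} (θ : L ≅ M) (x : M) :
    invImage θ.inv (invImage θ.hom x) = x :=
  invImage_hom_inv θ.symm x

/-- The left adjoint `k` of `snd^*` satisfies the Frobenius condition, and the Beck–Chevalley
condition with respect to the left adjoint `l` of the opposite side of the square. -/
structure IsDirectImage (fst : P ⟶ E) (snd : P ⟶ L) (g : L ⟶ B) (l : E → B) (k : P → L) :
    Prop where
  gc : GaloisConnection k (invImage snd)
  frobenius : ∀ (a : P) (b : L), k (a ⊓ invImage snd b) = k a ⊓ b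
  beckChevalley : ∀ a : E, k (invImage fst a) = invImage g (l a)

/-- Transfers the computation from the concrete tensor product to an arbitrary pullback. -/
lemma IsDirectImage.of_iso {Q : Locale.{u}} {l : E → B} {k : P → L}
    (hk : IsDirectImage fst snd g l k) (θ : Q ≅ P) {fst' : Q ⟶ E} {snd' : Q ⟶ L}
    (hfst : θ.hom ≫ fst = fst') (hsnd : θ.hom ≫ snd = snd') :
    IsDirectImage fst' snd' g l (fun x => k (invImage θ.inv x)) where
  gc x b := by
    rw [hk.gc, ← hsnd, invImage_comp]
    constructor
    · intro H
      rw [← invImage_hom_inv θ x]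
      exact OrderHomClass.mono (invImage θ.hom) H
    · intro H
      rw [← invImage_inv_hom θ (invImage snd b)]
      exact OrderHomClass.mono (invImage θ.inv) H
  frobenius x b := by
    rw [← hsnd, invImage_comp, map_inf, invImage_inv_hom, hk.frobenius]
  beckChevalley a := by
    rw [← hfst, invImage_comp, invImage_inv_hom, hk.beckChevalley]

/-- The Beck–Chevalley condition for pullbacks of open maps of locales. -/
lemma exists_isDirectImage_of_isPullback (h : IsPullback fst snd e g) {l : E → B}
    (gc : GaloisConnection l (invImage e))
    (frob : ∀ (a : E) (b : B), l (a ⊓ invImage e b) = l a ⊓ b) :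
    ∃ k : P → L, IsDirectImage fst snd g l k := by
  have hT := isPullback_tensor e g
  have hl : IsDirectImage (Frm.ofHom (FrmPushout.inl (invImage e) (invImage g))).op
      (Frm.ofHom (FrmPushout.inr (invImage e) (invImage g))).op g l
      (FrmPushout.directImage (invImage e) (invImage g) l) :=
    ⟨FrmPushout.directImage_gc gc frob, FrmPushout.directImage_inf_inr gc frob,
      FrmPushout.directImage_inl gc frob⟩
  exact ⟨_, hl.of_iso (h.isoIsPullback _ _ hT) (h.isoIsPullback_hom_fst _ _ hT)
    (h.isoIsPullback_hom_snd _ _ hT)⟩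

lemma IsOpenMap.of_isPullback (he : IsOpenMap e) (h : IsPullback fst snd e g) :
    IsOpenMap snd := by
  obtain ⟨l, gc, frob⟩ := he
  obtain ⟨k, gck, frobk, -⟩ := exists_isDirectImage_of_isPullback h gc frob
  exact ⟨k, gck, frobk⟩

lemma directImage_invImage_of_isSurjective {l : E → B} (gc : GaloisConnection l (invImage e))
    (hs : IsSurjective e) (b : B) : l (invImage e b) = b :=
  hs (gc.u_l_u_eq_u b)

/-- Surjectivity of the open map `e` gives `l ⊤ = ⊤`; Beck–Chevalley turns this into `k ⊤ = ⊤`, and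
Frobenius then makes `k` a left inverse of `snd^*`. -/
lemma IsSurjective.of_isPullback (he : IsOpenMap e) (hs : IsSurjective e)
    (h : IsPullback fst snd e g) : IsSurjective snd := by
  obtain ⟨l, gc, frob⟩ := he
  obtain ⟨k, -, frobk, bc⟩ := exists_isDirectImage_of_isPullback h gc frob
  have hl : l ⊤ = ⊤ := by
    simpa using directImage_invImage_of_isSurjective gc hs ⊤
  have hk : k ⊤ = ⊤ := by
    have := bc ⊤
    rwa [map_top, hl, map_top] at this
  refine Function.LeftInverse.injective (g := k) fun b => ?_
  have := frobk ⊤ b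
  rwa [hk, top_inf_eq, top_inf_eq] at this

lemma isIso_of_bijective {L M : Locale.{u}} (f : L ⟶ M)
    (hf : Function.Bijective (invImage f)) : IsIso f := by
  let o : M ≃o L :=
    { Equiv.ofBijective _ hf with
      map_rel_iff' := fun {a b} => by
        change invImage f a ≤ invImage f b ↔ a ≤ b
        rw [← inf_eq_left, ← map_inf, hf.1.eq_iff, inf_eq_left] }
  have : IsIso (Quiver.Hom.unop f) := (Frm.Iso.mk (α := M.unop) (β := L.unop) o).isIso_hom
  exact (isIso_unop_iff f).1 this

/-- A map whose pullback along an open surjection is an isomorphism is an isomorphism. -/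
lemma isIso_of_isPullback [IsIso fst] (he : IsOpenMap e) (hs : IsSurjective e)
    (h : IsPullback fst snd e g) : IsIso g := by
  have hs' := hs.of_isPullback he h
  obtain ⟨l, gc, frob⟩ := he
  obtain ⟨k, gck, -, bc⟩ := exists_isDirectImage_of_isPullback h gc frob
  refine isIso_of_bijective g ⟨fun x y hxy => hs ?_, fun w =>
    ⟨l (invImage (inv fst) (invImage snd w)), ?_⟩⟩
  -- As `fst` is invertible, `e` factors through `g`, so `g^* x` determines `e^* x`, and `e^*` is
  -- injective.
  · have key (x : B) : invImage e x = invImage (inv fst) (invImage snd (invImage g x)) := by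
      rw [← invImage_comp, ← invImage_comp, Category.assoc, ← h.w, IsIso.inv_hom_id_assoc]
    rw [key, key, hxy]
  -- Beck–Chevalley rewrites `g^*` of the witness as `k (snd^* w)`, which is `w` because `snd` is
  -- surjective.
  · rw [← bc, ← invImage_comp, IsIso.hom_inv_id]
    exact directImage_invImage_of_isSurjective gck hs' w

end Locale

/-! ### Actions on generalized elements -/

namespace GLocale

variable {G : LocalicGroupoid.{u}}

/-- The square of action locales induced by a map over `G₀`. -/
lemma isPullback_lift_snd {X Y : GLocale G} (f : X.X ⟶ Y.X) (hf : f ≫ Y.p = X.p) :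
    IsPullback
      (pullback.lift (pullback.fst G.r X.p) (pullback.snd G.r X.p ≫ f)
        (by simp [hf, pullback.condition]) : pullback G.r X.p ⟶ pullback G.r Y.p)
      (pullback.snd G.r X.p) (pullback.snd G.r Y.p) f := by
  refine IsPullback.flip (IsPullback.of_bot (v₂₁ := pullback.fst G.r Y.p) (v₂₂ := Y.p)
    (h₃₁ := G.r) ?_ (pullback.lift_snd _ _ _).symm (IsPullback.of_hasPullback G.r Y.p).flip)
  rw [pullback.lift_fst, hf]
  exact (IsPullback.of_hasPullback G.r X.p).flip

/-- Precomposition of the action with a map. -/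
lemma comp_lift_act {S T : Locale.{u}} (X : GLocale G) (k : S ⟶ T) (g : T ⟶ G.G₁) (x : T ⟶ X.X)
    (h : g ≫ G.r = x ≫ X.p) :
    k ≫ pullback.lift g x h ≫ X.act =
      pullback.lift (k ≫ g) (k ≫ x) (by simp [h]) ≫ X.act := by
  rw [← Category.assoc]
  congr 1
  apply pullback.hom_ext <;> simp only [Category.assoc, pullback.lift_fst, pullback.lift_snd]

/-- Associativity of the action for generalized elements. -/
lemma lift_lift_m_act (X : GLocale G) {T : Locale.{u}} (g h : T ⟶ G.G₁) (x : T ⟶ X.X)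
    (hgh : g ≫ G.r = h ≫ G.d) (hx : h ≫ G.r = x ≫ X.p) :
    pullback.lift (pullback.lift g h hgh ≫ G.m) x
        (by rw [Category.assoc, G.m_r, pullback.lift_snd_assoc, hx]) ≫ X.act =
      pullback.lift g (pullback.lift h x hx ≫ X.act)
        (by rw [Category.assoc, X.act_p, pullback.lift_fst_assoc, hgh]) ≫ X.act := by
  have key := congrArg (fun k => pullback.lift (f := G.r) (g := pullback.fst G.r X.p ≫ G.d)
    g (pullback.lift h x hx) (by rw [pullback.lift_fst_assoc, hgh]) ≫ k) X.assoc
  simp only [comp_lift_act, pullback.lift_fst, pullback.lift_snd, pullback.lift_snd_assoc] at key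
  convert key using 3
  rw [← Category.assoc]
  congr 1
  apply pullback.hom_ext <;> simp only [Category.assoc, pullback.lift_fst, pullback.lift_snd,
    pullback.lift_snd_assoc]

/-- The unit law of the action for generalized elements. -/
lemma lift_u_act (X : GLocale G) {T : Locale.{u}} (x : T ⟶ X.X) :
    pullback.lift (x ≫ X.p ≫ G.u) x (by simp [G.u_r]) ≫ X.act = x := by
  have key := congrArg (fun k => x ≫ k) X.unit_act
  simpa only [comp_lift_act, Category.comp_id] using key

end GLocale

/-! ### Equivariant maps between principal bundles -/

namespace GBundle

variable {G : LocalicGroupoid.{u}} {M : Locale.{u}}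

lemma IsPrincipal.isPullback {X : GBundle G M} (hX : X.IsPrincipal) :
    IsPullback X.act (pullback.snd G.r X.p) X.π X.π := by
  have := hX.isIso_pairing
  exact IsPullback.of_iso_pullback ⟨X.act_π⟩ (asIso X.pairing)
    (pullback.lift_fst _ _ _) (pullback.lift_snd _ _ _)

lemma isIso_pairing_of_isPullback {X : GBundle G M}
    (h : IsPullback X.act (pullback.snd G.r X.p) X.π X.π) : IsIso X.pairing := by
  have : X.pairing = h.isoPullback.hom := by
    apply pullback.hom_ext
    · exact (pullback.lift_fst _ _ _).trans h.isoPullback_hom_fst.symm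
    · exact (pullback.lift_snd _ _ _).trans h.isoPullback_hom_snd.symm
  rw [this]
  infer_instance

lemma isIso_of_isEquivariant {X Y : GBundle G M} (hX : X.IsPrincipal) (hY : Y.IsPrincipal)
    {φ : X.X ⟶ Y.X} (hφ : X.toGLocale.IsEquivariant Y.toGLocale φ) (hπ : φ ≫ Y.π = X.π) :
    IsIso φ := by
  -- After rewriting, this says that `(g, x) ↦ (g (φ x), x)` identifies `G₁ ×_{G₀} X` with `Y ×_M
  -- X`.
  have h₁ := (GLocale.isPullback_lift_snd φ hφ.comp_p).paste_horiz hY.isPullback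
  rw [← hφ.act_comp, hπ] at h₁
  -- Pasted with `h₁`, this square becomes the kernel pair square of `X`, so it is itself a
  -- pullback.
  have h₂ : IsPullback (𝟙 (pullback G.r X.p)) X.act (X.act ≫ φ) φ := by
    refine IsPullback.of_right (h₁₂ := pullback.snd G.r X.p) (h₂₂ := Y.π) (v₁₃ := X.π)
      ?_ (by simp) h₁.flip
    rw [Category.id_comp, hπ]
    exact hX.isPullback.flip
  exact Locale.isIso_of_isPullback (hX.isOpenMap_π.of_isPullback h₁.flip)
    (hX.isSurjective_π.of_isPullback hX.isOpenMap_π h₁.flip) h₂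

end GBundle

/-! ### Base change of principal bundles -/

namespace GBundle

variable {G : LocalicGroupoid.{u}} {M M' : Locale.{u}}

/-- The base change of a `G`-bundle along a map of bases. -/
noncomputable def baseChange (X : GBundle G M) (f : M' ⟶ M) : GBundle G M' where
  X := pullback X.π f
  p := pullback.fst X.π f ≫ X.p
  act := pullback.lift
    (pullback.lift (pullback.fst G.r (pullback.fst X.π f ≫ X.p))
      (pullback.snd G.r (pullback.fst X.π f ≫ X.p) ≫ pullback.fst X.π f)
      (by rw [pullback.condition, Category.assoc]) ≫ X.act)
    (pullback.snd G.r (pullback.fst X.π f ≫ X.p) ≫ pullback.snd X.π f)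
    (by rw [Category.assoc, X.act_π, pullback.lift_snd_assoc, Category.assoc, Category.assoc,
      pullback.condition])
  act_p := by
    rw [pullback.lift_fst_assoc, Category.assoc, X.act_p, pullback.lift_fst_assoc]
  assoc := by
    apply pullback.hom_ext
    · simp only [Category.assoc, pullback.lift_fst, GLocale.comp_lift_act, pullback.lift_snd_assoc]
      exact X.lift_lift_m_act _ _ _ _ _
    · simp only [Category.assoc, pullback.lift_snd, pullback.lift_snd_assoc]
  unit_act := by
    apply pullback.hom_ext
    · simp only [Category.assoc, pullback.lift_fst, GLocale.comp_lift_act, pullback.lift_snd_assoc,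
        Category.id_comp]
      exact X.lift_u_act _
    · simp only [Category.assoc, pullback.lift_snd, pullback.lift_snd_assoc]
  π := pullback.snd X.π f
  act_π := pullback.lift_snd _ _ _

/-- The projection of the base change to the original bundle. -/
noncomputable def baseChangeMap (X : GBundle G M) (f : M' ⟶ M) : (X.baseChange f).X ⟶ X.X :=
  pullback.fst X.π f

variable (X : GBundle G M) (f : M' ⟶ M)

lemma isPullback_baseChange : IsPullback (X.baseChangeMap f) (X.baseChange f).π X.π f :=
  IsPullback.of_hasPullback X.π f

lemma isEquivariant_baseChangeMap :
    (X.baseChange f).toGLocale.IsEquivariant X.toGLocale (X.baseChangeMap f) where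
  comp_p := rfl
  act_comp := pullback.lift_fst _ _ _

variable {X}

lemma IsPrincipal.baseChange (hX : X.IsPrincipal) : (X.baseChange f).IsPrincipal where
  isIso_pairing := by
    have hf := X.isEquivariant_baseChangeMap f
    -- The kernel pair square of `X`, pulled back along the base change map, is the desired square
    -- for the base change pasted with the defining pullback, which can be cancelled.
    have h := (GLocale.isPullback_lift_snd _ hf.comp_p).paste_horiz hX.isPullback
    rw [← hf.act_comp, (X.isPullback_baseChange f).w] at h
    exact isIso_pairing_of_isPullback
      (h.of_right (X.baseChange f).act_π (X.isPullback_baseChange f))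
  isOpenMap_π := hX.isOpenMap_π.of_isPullback (X.isPullback_baseChange f)
  isSurjective_π := hX.isSurjective_π.of_isPullback hX.isOpenMap_π (X.isPullback_baseChange f)

variable {f}

/-- Equality of maps into the pullback is tested on components: towards `X` it is the equivariance
of the composite, towards `M'` the invariance of both projections. -/
lemma isEquivariant_of_comp_baseChangeMap {X' : GBundle G M'} {φ : X'.X ⟶ (X.baseChange f).X}
    (hφ : X'.toGLocale.IsEquivariant X.toGLocale (φ ≫ X.baseChangeMap f))
    (hπ : φ ≫ (X.baseChange f).π = X'.π) :
    X'.toGLocale.IsEquivariant (X.baseChange f).toGLocale φ where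
  comp_p := by
    rw [← hφ.comp_p, Category.assoc]
    rfl
  act_comp := by
    have hf := X.isEquivariant_baseChangeMap f
    apply (X.isPullback_baseChange f).hom_ext
    · refine ((Category.assoc _ _ _).trans hφ.act_comp).trans
        (Eq.trans ?_ (Category.assoc _ _ _).symm)
      rw [hf.act_comp, GLocale.comp_lift_act]
      congr 1
      apply pullback.hom_ext <;> simp only [pullback.lift_fst, pullback.lift_snd,
        pullback.lift_snd_assoc, Category.assoc]
    · rw [Category.assoc, Category.assoc, hπ, X'.act_π, (X.baseChange f).act_π,
        pullback.lift_snd_assoc, Category.assoc, hπ]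

end GBundle

theorem mainTheorem6 (G : LocalicGroupoid.{u}) (hG : G.IsOpen) {M M' : Locale.{u}}
    (X : GBundle G M) (hX : X.IsPrincipal) (f : M' ⟶ M) :
    ∃ (Y : GBundle G M') (fY : Y.X ⟶ X.X),
      Y.IsPrincipal ∧
      Y.toGLocale.IsEquivariant X.toGLocale fY ∧
      IsPullback fY Y.π X.π f ∧
      ∀ (X' : GBundle G M') (f' : X'.X ⟶ X.X), X'.IsPrincipal →
        X'.toGLocale.IsEquivariant X.toGLocale f' → f' ≫ X.π = X'.π ≫ f →
        ∃! φ : X'.X ≅ Y.X, X'.IsBundleIso Y φ ∧ φ.hom ≫ fY = f' := by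
  have hP := X.isPullback_baseChange f
  refine ⟨X.baseChange f, X.baseChangeMap f, hX.baseChange f, X.isEquivariant_baseChangeMap f,
    hP, fun X' f' hX' hf' hw => ?_⟩
  have h₁ : hP.lift f' X'.π hw ≫ X.baseChangeMap f = f' := hP.lift_fst _ _ _
  have h₂ : hP.lift f' X'.π hw ≫ (X.baseChange f).π = X'.π := hP.lift_snd _ _ _
  have hφ := GBundle.isEquivariant_of_comp_baseChangeMap (h₁.symm ▸ hf') h₂
  have := GBundle.isIso_of_isEquivariant hX' (hX.baseChange f) hφ h₂
  refine ⟨asIso (hP.lift f' X'.π hw), ⟨⟨hφ, h₂⟩, h₁⟩, fun ψ hψ => Iso.ext (hP.hom_ext ?_ ?_)⟩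
  · exact hψ.2.trans h₁.symm
  · exact hψ.1.comp_π.trans h₂.symm
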